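/- Let $\Gamma$ be a countable group with a left-invariant distance $d$ that is proper (every ball is finite), and write $|g|=d(g,e)$. Let $\mu$ be a symmetric probability measure on $\Gamma$ (i.e. $\mu(g^{-1})=\mu(g)$ for all $g$) with finite second moment, and put $M_2(\mu)=\bigl(\sum_g |g|^2\mu(g)\bigr)^{1/2}<\infty$. Let $\mu^{*n}$ be the $n$-fold convolution of $\mu$ (with $\mu^{*0}=\delta_e$), and $$h=\lim_n -\frac1n\sum_g \mu^{*n}(g)\log\mu^{*n}(g)\in[0,\infty],\qquad \rho=\limsup_n \sqrt[n]{\mu^{*n}(e)},\qquad \ell=\lim_n\frac1n\sum_g|g|\,\mu^{*n}(g).$$ For $-1<x<1$ let $A(x)=2x\,\mathrm{artanh}(x)+4\sqrt{1-x^2}-4$. Then $A\ge 0$ on $(-1,1)$, the limits defining $h$ and $\ell$ exist, $0\le \ell/M_2(\mu)<1$ (where $\ell/M_2(\mu)$ is read as $0$ if $M_2(\mu)=0$, i.e. $\mu=\delta_e$), and $$A\bigl(\ell/M_2(\mu)\bigr)+4(1-\rho)\le h .$$ In particular $4(1-\rho)\le h$ (Ledrappier's inequality). -/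

import Mathlib

open Filter Topology
open scoped ENNReal

noncomputable section

namespace RandomWalk

/-- The `n`-fold convolution `μ^{*n}`: the law of `X_n = γ_1 ⋯ γ_n` (with `X_0 = 1`), where the
`γ_i` are independent with law `μ`. -/
def convPow {Γ : Type*} [Group Γ] (μ : PMF Γ) : ℕ → PMF Γ
  | 0 => PMF.pure 1
  | n + 1 => (convPow μ n).bind fun x => μ.map fun g => x * g

/-- `μ` is symmetric: `μ(g⁻¹) = μ(g)`. -/
def IsSymmetric {Γ : Type*} [Group Γ] (μ : PMF Γ) : Prop :=
  ∀ g : Γ, μ g⁻¹ = μ g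

/-- The entropy `H(ν) = -∑ ν(g) log ν(g)`, in `[0, ∞]` (all terms are nonnegative). -/
def entropy {Γ : Type*} (ν : PMF Γ) : ℝ≥0∞ :=
  ∑' g, ENNReal.ofReal (-((ν g).toReal * Real.log (ν g).toReal))

/-- The mean distance to the identity `∑ |g| ν(g)`, in `[0, ∞]`. -/
def meanLength {Γ : Type*} [Group Γ] [MetricSpace Γ] (ν : PMF Γ) : ℝ≥0∞ :=
  ∑' g, edist g 1 * ν g

/-- `M₂(ν) = (∑ |g|² ν(g))^{1/2}`, in `[0, ∞]`. -/
def M₂ {Γ : Type*} [Group Γ] [MetricSpace Γ] (ν : PMF Γ) : ℝ≥0∞ :=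
  (∑' g, edist g 1 ^ 2 * ν g) ^ (1 / 2 : ℝ)

/-- The asymptotic entropy `h = lim H(μ^{*n}) / n`, in `[0, ∞]`. -/
def asymptoticEntropy {Γ : Type*} [Group Γ] (μ : PMF Γ) : ℝ≥0∞ :=
  limUnder atTop fun n : ℕ => entropy (convPow μ n) / n

/-- The drift `ℓ = lim (∑ |g| μ^{*n}(g)) / n`, in `[0, ∞]`. -/
def drift {Γ : Type*} [Group Γ] [MetricSpace Γ] (μ : PMF Γ) : ℝ≥0∞ :=
  limUnder atTop fun n : ℕ => meanLength (convPow μ n) / n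

/-- The spectral radius `ρ = limsup μ^{*n}(1)^{1/n}`. -/
def spectralRadius {Γ : Type*} [Group Γ] (μ : PMF Γ) : ℝ :=
  limsup (fun n : ℕ => (convPow μ n 1).toReal ^ (1 / n : ℝ)) atTop

/-- `A(x) = 2 x artanh x + 4 √(1 - x²) - 4`, for `-1 < x < 1`. -/
def A (x : ℝ) : ℝ :=
  2 * x * Real.artanh x + 4 * √(1 - x ^ 2) - 4

end RandomWalk

end

noncomputable section

namespace RandomWalk

/-! ### The function `A` -/

/-! Let `Q` be the law of the walk at an independent geometric time, so that `Q = ε δ₁ + (1 - ε) μ *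
Q`. Summation by parts over the edges `(x, g⁻¹ x)`, weighted by `μ g` (`hasSum_edge_resolvent`),
writes `ε / (1 - ε) * (∑ F Q - F 1)` as the sum of `(F x - F (g⁻¹ x)) (Q (g⁻¹ x) - Q x) / 2`. The
choice `F = -log Q` produces the entropy of `Q`, and `F = |·|` its mean length.

On an edge with end masses `a`, `b`, put `X = (b - a) / (a + b)`. The entropy term equals `(a + b) /
2 * A X + 2 (a + b) - 4 √a √b`. Summed over edges, `√a √b` gives `⟨√Q, P √Q⟩ ≤ ρ`
(`summable_and_tsum_sqrt_le`) and `2 (a + b)` gives `4`; this is the term `4 (1 - ρ)`.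

It remains to bound the mean of `A X` for the probability weights `μ g (a + b) / 2`. As `|·|` varies
by at most `|g|` along an edge, the length identity gives `E (|g| |X|) ≥ ℓ`, while `E |g|² = M₂²`;
hence `E X² ≥ (ℓ / M₂)²`. Since `A` is convex and increasing in `x²`, `E (A X) ≥ A (ℓ / M₂)`.
`A_edge_le` carries this out edge by edge, with a tangent in place of Jensen and a completed square
in place of Cauchy-Schwarz.

Finally `ε → 0`: the entropy of `Q` is at most that of the clock plus the averaged entropy of the
walk, and after multiplication by `ε / (1 - ε)` the clock's share vanishes. -/

lemma two_mul_artanh {x : ℝ} (hx : x ∈ Set.Ioo (-1 : ℝ) 1) :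
    2 * Real.artanh x = Real.log (1 + x) - Real.log (1 - x) := by
  have h1 : 1 + x ≠ 0 := by linarith [hx.1]
  have h2 : 1 - x ≠ 0 := by linarith [hx.2]
  rw [Real.artanh_eq_half_log ⟨hx.1.le, hx.2.le⟩, Real.log_div h1 h2]
  ring

lemma A_eq_log {x : ℝ} (hx : x ∈ Set.Ioo (-1 : ℝ) 1) :
    A x = x * (Real.log (1 + x) - Real.log (1 - x)) + 4 * √(1 - x ^ 2) - 4 := by
  rw [A, ← two_mul_artanh hx]
  ring

lemma A_abs {x : ℝ} (hx : x ∈ Set.Ioo (-1 : ℝ) 1) : A |x| = A x := by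
  rcases abs_cases x with ⟨h, -⟩ | ⟨h, -⟩
  · rw [h]
  · have hx' : -x ∈ Set.Ioo (-1 : ℝ) 1 := ⟨by linarith [hx.2], by linarith [hx.1]⟩
    rw [h, A_eq_log hx, A_eq_log hx', neg_sq, sub_neg_eq_add, ← sub_eq_add_neg]
    ring

/-- The slope `A'(x) / (2 x)`, that is, the derivative of `A` with respect to `x²`. -/
def slopeA (x : ℝ) : ℝ :=
  (1 / √(1 - x ^ 2) - 1) ^ 2 + (∑' k : ℕ, x ^ (2 * k) / (2 * k + 1) - 1)

lemma summable_slopeA {x : ℝ} (hx : x ∈ Set.Ioo (-1 : ℝ) 1) :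
    Summable fun k : ℕ => x ^ (2 * k) / (2 * k + 1 : ℝ) := by
  have hx2 : x ^ 2 < 1 := by nlinarith [hx.1, hx.2]
  refine Summable.of_nonneg_of_le (fun k => ?_) (fun k => ?_)
    (summable_geometric_of_lt_one (sq_nonneg x) hx2)
  · rw [pow_mul]; positivity
  · rw [pow_mul]
    exact div_le_self (by positivity) (by linarith [(Nat.cast_nonneg k : (0 : ℝ) ≤ k)])

lemma mul_tsum_eq_artanh {x : ℝ} (hx : x ∈ Set.Ioo (-1 : ℝ) 1) :
    2 * x * ∑' k : ℕ, x ^ (2 * k) / (2 * k + 1 : ℝ) = Real.log (1 + x) - Real.log (1 - x) := by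
  rw [← (Real.hasSum_log_sub_log_of_abs_lt_one (abs_lt.2 hx)).tsum_eq, ← tsum_mul_left]
  refine tsum_congr fun k => ?_
  rw [pow_succ]
  ring

/-- Each summand increases on `[0, 1)`: one is the square of a nonnegative increasing function, the
other a power series with nonnegative coefficients. This is the convexity of `A` in `x²`. -/
lemma slopeA_mono {x y : ℝ} (hx : 0 ≤ x) (hxy : x ≤ y) (hy : y < 1) :
    slopeA x ≤ slopeA y := by
  have hy2 : 0 < 1 - y ^ 2 := by nlinarith
  have hyx : 1 - y ^ 2 ≤ 1 - x ^ 2 := by nlinarith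
  have h0 : 0 < √(1 - y ^ 2) := Real.sqrt_pos.2 hy2
  have h1 : 1 ≤ 1 / √(1 - x ^ 2) := by
    rw [le_div_iff₀ (h0.trans_le (Real.sqrt_le_sqrt hyx)), one_mul]
    exact Real.sqrt_le_one.2 (by nlinarith)
  have h2 : 1 / √(1 - x ^ 2) ≤ 1 / √(1 - y ^ 2) :=
    one_div_le_one_div_of_le h0 (Real.sqrt_le_sqrt hyx)
  have h3 : ∑' k : ℕ, x ^ (2 * k) / (2 * k + 1 : ℝ) ≤ ∑' k : ℕ, y ^ (2 * k) / (2 * k + 1 : ℝ) :=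
    (summable_slopeA ⟨by linarith, by linarith⟩).tsum_le_tsum
      (fun k => by gcongr) (summable_slopeA ⟨by linarith, hy⟩)
  unfold slopeA
  have := pow_le_pow_left₀ (sub_nonneg.2 h1) (sub_le_sub_right h2 1) 2
  linarith

lemma slopeA_nonneg {x : ℝ} (hx : 0 ≤ x) (hx1 : x < 1) : 0 ≤ slopeA x := by
  have h0 : slopeA 0 = 0 := by
    have : ∑' k : ℕ, (0 : ℝ) ^ (2 * k) / (2 * k + 1 : ℝ) = 1 := by
      rw [tsum_eq_single 0 fun k hk => by simp [hk]]
      simp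
    rw [slopeA, this]
    simp
  exact h0 ▸ slopeA_mono le_rfl hx hx1

lemma hasDerivAt_A {x : ℝ} (hx : x ∈ Set.Ioo (-1 : ℝ) 1) :
    HasDerivAt A (2 * x * slopeA x) x := by
  have h1 : 1 + x ≠ 0 := by linarith [hx.1]
  have h2 : 1 - x ≠ 0 := by linarith [hx.2]
  have h3 : 0 < 1 - x ^ 2 := by nlinarith [hx.1, hx.2]
  have d1 : HasDerivAt (fun y : ℝ => Real.log (1 + y)) (1 / (1 + x)) x :=
    ((hasDerivAt_id x).const_add 1).log h1
  have d2 : HasDerivAt (fun y : ℝ => Real.log (1 - y)) (-1 / (1 - x)) x :=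
    ((hasDerivAt_id x).const_sub 1).log h2
  have d3 : HasDerivAt (fun y : ℝ => √(1 - y ^ 2)) (-(2 * x) / (2 * √(1 - x ^ 2))) x := by
    have := ((hasDerivAt_pow 2 x).const_sub 1).sqrt h3.ne'
    simpa using this
  have d := (((hasDerivAt_id x).mul (d1.sub d2)).add (d3.const_mul 4)).sub_const 4
  refine (d.congr_of_eventuallyEq (f₁ := A) ?_).congr_deriv ?_
  · filter_upwards [Ioo_mem_nhds hx.1 hx.2] with y hy
    rw [A_eq_log hy]
    simp
  · have hs : √(1 - x ^ 2) ≠ 0 := (Real.sqrt_pos.2 h3).ne'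
    have e1 : (1 / √(1 - x ^ 2)) ^ 2 = 1 / (1 - x ^ 2) := by
      rw [div_pow, Real.sq_sqrt h3.le, one_pow]
    have e2 : 1 / (1 + x) - -1 / (1 - x) = 2 * (1 / (1 - x ^ 2)) := by
      have : 1 - x ^ 2 ≠ 0 := h3.ne'
      field_simp
      ring
    have e3 : -(2 * x) / (2 * √(1 - x ^ 2)) = - x * (1 / √(1 - x ^ 2)) := by
      field_simp
    simp only [Pi.sub_apply, id, one_mul]
    rw [e2, e3, slopeA, ← mul_tsum_eq_artanh hx, ← e1]
    ring

/-- `A`, as a function of `x²`, lies above its tangents. -/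
lemma A_tangent {x₀ x : ℝ} (h₀ : 0 ≤ x₀) (h₁ : x₀ < 1) (hx : x ∈ Set.Ioo (-1 : ℝ) 1) :
    A x₀ + slopeA x₀ * (x ^ 2 - x₀ ^ 2) ≤ A x := by
  rw [← A_abs hx, ← sq_abs x]
  have hx0 := abs_nonneg x
  have hx1 : |x| < 1 := abs_lt.2 hx
  generalize |x| = y at hx0 hx1
  -- The derivative of `f` is nonpositive on `[0, x₀]` and nonnegative beyond, so `x₀` minimizes `f`
  -- on `[0, 1)`.
  let f : ℝ → ℝ := fun y => A y - slopeA x₀ * y ^ 2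
  have hf : ∀ z ∈ Set.Ioo (-1 : ℝ) 1, HasDerivAt f (2 * z * (slopeA z - slopeA x₀)) z := by
    intro z hz
    refine ((hasDerivAt_A hz).sub ((hasDerivAt_pow 2 z).const_mul (slopeA x₀))).congr_deriv ?_
    simp
    ring
  suffices f x₀ ≤ f y by simp only [f] at this; linarith
  rcases le_total y x₀ with h | h
  · refine antitoneOn_of_deriv_nonpos (convex_Icc 0 x₀)
      (fun z hz => (hf z ⟨by linarith [hz.1], by linarith [hz.2]⟩).continuousAt.continuousWithinAt)
      (fun z hz => ?_) (fun z hz => ?_) ⟨hx0, h⟩ ⟨h₀, le_rfl⟩ h <;> rw [interior_Icc] at hz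
    · exact (hf z ⟨by linarith [hz.1], by linarith [hz.2]⟩).differentiableAt.differentiableWithinAt
    · rw [(hf z ⟨by linarith [hz.1], by linarith [hz.2]⟩).deriv]
      exact mul_nonpos_of_nonneg_of_nonpos (by linarith [hz.1])
        (sub_nonpos.2 (slopeA_mono hz.1.le hz.2.le h₁))
  · refine monotoneOn_of_deriv_nonneg (convex_Icc x₀ y)
      (fun z hz => (hf z ⟨by linarith [hz.1], by linarith [hz.2]⟩).continuousAt.continuousWithinAt)
      (fun z hz => ?_) (fun z hz => ?_) ⟨le_rfl, h⟩ ⟨h, le_rfl⟩ h <;> rw [interior_Icc] at hz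
    · exact (hf z ⟨by linarith [hz.1], by linarith [hz.2]⟩).differentiableAt.differentiableWithinAt
    · rw [(hf z ⟨by linarith [hz.1], by linarith [hz.2]⟩).deriv]
      exact mul_nonneg (by linarith [hz.1])
        (sub_nonneg.2 (slopeA_mono h₀ hz.1.le (hz.2.trans hx1)))

lemma A_zero : A 0 = 0 := by simp [A]

lemma A_nonneg {x : ℝ} (hx : x ∈ Set.Ioo (-1 : ℝ) 1) : 0 ≤ A x := by
  have h := A_tangent le_rfl one_pos hx
  have := mul_nonneg (slopeA_nonneg le_rfl one_pos) (sq_nonneg x)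
  rw [A_zero] at h
  linarith

/-- The inequality that is summed over the edges `(x, g⁻¹ x)`, where `a` and `b` are the masses of
the two ends and `r` is the length of `g`. -/
lemma A_edge_le {x₀ a b : ℝ} (h₀ : 0 ≤ x₀) (h₁ : x₀ < 1) (ha : 0 ≤ a) (hb : 0 ≤ b)
    (hab : a = 0 ↔ b = 0) (t r : ℝ) :
    (A x₀ - slopeA x₀ * x₀ ^ 2) * ((a + b) / 2) +
        slopeA x₀ * (2 * t * r * |b - a| / 2 - t ^ 2 * r ^ 2 * ((a + b) / 2)) ≤
      (b - a) * (Real.log b - Real.log a) / 2 + 4 * (√a * √b) - 2 * (a + b) := by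
  -- If one end is massless, `hab` makes both so and all terms vanish; with a single massless end
  -- the convention `log 0 = 0` would break the bound.
  rcases ha.eq_or_lt with rfl | ha
  · simp [hab.1 rfl]
  have hb : 0 < b := hb.lt_of_ne fun h => ha.ne' (hab.2 h.symm)
  have hs : 0 < a + b := by positivity
  set X := (b - a) / (a + b) with hX
  have hbX : b - a = X * (a + b) := by rw [hX]; field_simp
  have e1 : 1 + X = 2 * b / (a + b) := by rw [hX]; field_simp; ring
  have e2 : 1 - X = 2 * a / (a + b) := by rw [hX]; field_simp; ring
  have hXm : X ∈ Set.Ioo (-1 : ℝ) 1 := by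
    constructor
    · have : 0 < 1 + X := by rw [e1]; positivity
      linarith
    · have : 0 < 1 - X := by rw [e2]; positivity
      linarith
  have e3 : Real.log (1 + X) - Real.log (1 - X) = Real.log b - Real.log a := by
    rw [e1, e2, Real.log_div (by positivity) hs.ne', Real.log_div (by positivity) hs.ne',
      Real.log_mul two_ne_zero hb.ne', Real.log_mul two_ne_zero ha.ne']
    ring
  have e4 : √(1 - X ^ 2) = 2 * (√a * √b) / (a + b) := by
    rw [show 1 - X ^ 2 = (1 + X) * (1 - X) by ring, e1, e2, ← Real.sqrt_mul ha.le,
      Real.sqrt_eq_iff_mul_self_eq (by positivity) (by positivity)]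
    have := Real.sq_sqrt (mul_nonneg hb.le ha.le)
    field_simp
    linarith
  have hAX : (a + b) / 2 * A X =
      (b - a) * (Real.log b - Real.log a) / 2 + 4 * (√a * √b) - 2 * (a + b) := by
    rw [A_eq_log hXm, e3, e4, hbX]
    field_simp
    ring
  -- Expanding `(|X| - t r)² ≥ 0` makes the bound linear in `|b - a|`, which the length identity
  -- controls after summation.
  have hX2 : 2 * t * r * |X| - t ^ 2 * r ^ 2 ≤ X ^ 2 := by
    nlinarith [sq_nonneg (|X| - t * r), sq_abs X]
  have habs : |b - a| = |X| * (a + b) := by rw [hbX, abs_mul, abs_of_pos hs]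
  have hT := A_tangent h₀ h₁ hXm
  have hc := slopeA_nonneg h₀ h₁
  rw [← hAX, habs]
  have := mul_le_mul_of_nonneg_left hX2 hc
  calc _ = (a + b) / 2 * (A x₀ - slopeA x₀ * x₀ ^ 2 +
        slopeA x₀ * (2 * t * r * |X| - t ^ 2 * r ^ 2)) := by ring
    _ ≤ _ := mul_le_mul_of_nonneg_left (by linarith) (by positivity)

/-! ### Sums in `[0, ∞]` -/

lemma two_mul_le_add_sq_ennreal (a b : ℝ≥0∞) : 2 * (a * b) ≤ a ^ 2 + b ^ 2 := by
  wlog h : a ≤ b generalizing a b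
  · rw [mul_comm a, add_comm]
    exact this b a (le_of_not_ge h)
  obtain ⟨c, rfl⟩ := exists_add_of_le h
  calc 2 * (a * (a + c)) ≤ 2 * (a * (a + c)) + c ^ 2 := le_self_add
    _ = a ^ 2 + (a + c) ^ 2 := by ring

/-- The Cauchy-Schwarz inequality for weighted sums in `[0, ∞]`. -/
lemma tsum_mul_sq_le {ι : Type*} (w f g : ι → ℝ≥0∞) :
    (∑' i, w i * (f i * g i)) ^ 2 ≤ (∑' i, w i * f i ^ 2) * ∑' i, w i * g i ^ 2 := by
  have e : ∀ a b : ι → ℝ≥0∞, (∑' i, a i) * ∑' j, b j = ∑' i, ∑' j, a i * b j := fun a b => by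
    simp_rw [ENNReal.tsum_mul_left, ENNReal.tsum_mul_right]
  -- Doubling permits symmetrizing the double sum in `(i, j)`, so that `2ab ≤ a² + b²` applies
  -- termwise.
  refine (ENNReal.mul_le_mul_iff_right two_ne_zero ENNReal.ofNat_ne_top).1 ?_
  calc 2 * (∑' i, w i * (f i * g i)) ^ 2
      = ∑' i, ∑' j, w i * w j * (2 * ((f i * g j) * (f j * g i))) := by
        rw [sq, e, ← ENNReal.tsum_mul_left]
        refine tsum_congr fun i => ?_
        rw [← ENNReal.tsum_mul_left]
        exact tsum_congr fun j => by ring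
    _ ≤ ∑' i, ∑' j, (w i * f i ^ 2 * (w j * g j ^ 2) + w j * f j ^ 2 * (w i * g i ^ 2)) := by
        refine ENNReal.tsum_le_tsum fun i => ENNReal.tsum_le_tsum fun j => ?_
        calc _ ≤ w i * w j * ((f i * g j) ^ 2 + (f j * g i) ^ 2) := by
              gcongr
              exact two_mul_le_add_sq_ennreal _ _
          _ = _ := by ring
    _ = 2 * ((∑' i, w i * f i ^ 2) * ∑' i, w i * g i ^ 2) := by
        simp_rw [ENNReal.tsum_add]
        rw [two_mul, e]
        congr 1
        exact ENNReal.tsum_comm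

lemma tsum_bind_mul {α β : Type*} (p : PMF α) (κ : α → PMF β) (f : β → ℝ≥0∞) :
    ∑' b, f b * p.bind κ b = ∑' a, p a * ∑' b, f b * κ a b := by
  simp_rw [PMF.bind_apply, ← ENNReal.tsum_mul_left]
  rw [ENNReal.tsum_comm]
  exact tsum_congr fun a => tsum_congr fun b => by ring

/-- Fekete's lemma in `[0, ∞]`. -/
lemma tendsto_div_of_subadditive {u : ℕ → ℝ≥0∞} (hu : ∀ m n, u (m + n) ≤ u m + u n)
    (htop : ∀ n, u n ≠ ∞) :
    Tendsto (fun n => u n / n) atTop (𝓝 (limUnder atTop fun n => u n / n)) ∧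
      (limUnder atTop fun n => u n / n) ≠ ∞ ∧
      ∀ n : ℕ, n * (limUnder atTop fun n => u n / n) ≤ u n := by
  have hsub : Subadditive fun n => (u n).toReal := fun m n => by
    rw [← ENNReal.toReal_add (htop m) (htop n)]
    exact ENNReal.toReal_mono (ENNReal.add_ne_top.2 ⟨htop m, htop n⟩) (hu m n)
  have hbdd : BddBelow (Set.range fun n : ℕ => (u n).toReal / n) :=
    ⟨0, by rintro _ ⟨n, rfl⟩; positivity⟩
  have hlim := ENNReal.tendsto_ofReal (hsub.tendsto_lim hbdd)
  have hlim' : Tendsto (fun n => u n / n) atTop (𝓝 (ENNReal.ofReal hsub.lim)) := by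
    refine hlim.congr' ?_
    filter_upwards [eventually_gt_atTop 0] with n hn
    rw [ENNReal.ofReal_div_of_pos (by exact_mod_cast hn), ENNReal.ofReal_toReal (htop n),
      ENNReal.ofReal_natCast]
  rw [hlim'.limUnder_eq]
  refine ⟨hlim', ENNReal.ofReal_ne_top, fun n => ?_⟩
  rcases Nat.eq_zero_or_pos n with rfl | hn
  · simp
  have h := hsub.lim_le_div hbdd hn.ne'
  rw [le_div_iff₀ (by exact_mod_cast hn), mul_comm] at h
  calc (n : ℝ≥0∞) * ENNReal.ofReal hsub.lim = ENNReal.ofReal (n * hsub.lim) := by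
        rw [ENNReal.ofReal_mul n.cast_nonneg, ENNReal.ofReal_natCast]
    _ ≤ u n := ENNReal.ofReal_le_of_le_toReal h

/-! ### Entropy of mixtures -/

/-- The information content `-log a`, as an element of `[0, ∞]`. -/
def info (a : ℝ≥0∞) : ℝ≥0∞ :=
  ENNReal.ofReal (-Real.log a.toReal)

lemma entropy_eq_tsum_info {α : Type*} (ν : PMF α) : entropy ν = ∑' x, info (ν x) * ν x := by
  refine tsum_congr fun x => ?_
  rw [← mul_neg, ENNReal.ofReal_mul ENNReal.toReal_nonneg, ENNReal.ofReal_toReal (ν.apply_ne_top x),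
    mul_comm, info]

lemma info_anti {a b : ℝ≥0∞} (ha : a ≠ 0) (hab : a ≤ b) (hb : b ≠ ∞) : info b ≤ info a := by
  refine ENNReal.ofReal_le_ofReal (neg_le_neg (Real.log_le_log ?_ (ENNReal.toReal_mono hb hab)))
  exact ENNReal.toReal_pos ha (ne_top_of_le_ne_top hb hab)

lemma info_mul_le {a b : ℝ≥0∞} (ha : a ≠ 0) (hb : b ≠ 0) (ha' : a ≠ ∞) (hb' : b ≠ ∞) :
    info (a * b) ≤ info a + info b := by
  rw [info, ENNReal.toReal_mul, Real.log_mul (ENNReal.toReal_pos ha ha').ne'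
    (ENNReal.toReal_pos hb hb').ne', neg_add]
  exact ENNReal.ofReal_add_le

/-- The mixture dominates each `w a * κ a b`, and `info` is antitone and subadditive on products. -/
lemma entropy_bind_le {α β : Type*} (w : PMF α) (κ : α → PMF β) :
    entropy (w.bind κ) ≤ entropy w + ∑' a, w a * entropy (κ a) := by
  simp_rw [entropy_eq_tsum_info]
  rw [tsum_bind_mul, ← ENNReal.tsum_add]
  refine ENNReal.tsum_le_tsum fun a => ?_
  calc w a * ∑' b, info (w.bind κ b) * κ a b
      ≤ w a * ∑' b, (info (w a) * κ a b + info (κ a b) * κ a b) := by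
        rcases eq_or_ne (w a) 0 with ha | ha
        · simp [ha]
        gcongr with b
        rcases eq_or_ne (κ a b) 0 with hb | hb
        · simp [hb]
        rw [← add_mul]
        gcongr
        refine (info_anti (mul_ne_zero ha hb) ?_ (PMF.apply_ne_top _ _)).trans
          (info_mul_le ha hb (PMF.apply_ne_top _ _) (PMF.apply_ne_top _ _))
        rw [PMF.bind_apply]
        exact ENNReal.le_tsum a
    _ = info (w a) * w a + w a * ∑' b, info (κ a b) * κ a b := by
        rw [ENNReal.tsum_add, ENNReal.tsum_mul_left, PMF.tsum_coe, mul_one, mul_add, mul_comm (w a)]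

/-- Pointwise Gibbs inequality, from `log (b / a) ≤ b / a - 1`. Subtractions are cleared so that it
can be summed in `[0, ∞]`; the added masses then total `1` on both sides and cancel. -/
lemma info_mul_add_le {a b : ℝ≥0∞} (ha : a ≤ 1) (hb : b ≠ 0) (hb' : b ≤ 1) :
    info a * a + a ≤ info b * a + b := by
  rcases eq_or_ne a 0 with rfl | ha0
  · simp
  have hat := ne_top_of_le_ne_top ENNReal.one_ne_top ha
  have hbt := ne_top_of_le_ne_top ENNReal.one_ne_top hb'
  lift a to NNReal using hat
  lift b to NNReal using hbt
  have ha' : (0 : ℝ) < a := by exact_mod_cast pos_iff_ne_zero.2 ha0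
  have hb0 : (0 : ℝ) < b := by exact_mod_cast pos_iff_ne_zero.2 hb
  have ha1 : (a : ℝ) ≤ 1 := by exact_mod_cast ha
  have hb1 : (b : ℝ) ≤ 1 := by exact_mod_cast hb'
  have hla := Real.log_nonpos ha'.le ha1
  have hlb := Real.log_nonpos hb0.le hb1
  have hlog : Real.log b - Real.log a ≤ b / a - 1 := by
    rw [← Real.log_div hb0.ne' ha'.ne']
    exact Real.log_le_sub_one_of_pos (by positivity)
  have key : -Real.log a * a + a ≤ -Real.log b * a + b := by
    have := mul_le_mul_of_nonneg_right hlog ha'.le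
    rw [sub_mul, sub_mul, div_mul_cancel₀ _ ha'.ne'] at this
    linarith
  have e : ∀ c : NNReal, Real.log c ≤ 0 → ∀ d : NNReal,
      info c * a + d = ENNReal.ofReal (-Real.log c * a + d) := fun c hc d => by
    rw [ENNReal.ofReal_add (p := -Real.log c * a) (mul_nonneg (by linarith) ha'.le) d.coe_nonneg, ENNReal.ofReal_mul (by linarith),
      ENNReal.ofReal_coe_nnreal, ENNReal.ofReal_coe_nnreal, info, ENNReal.coe_toReal]
  rw [e a hla, e b hlb]
  exact ENNReal.ofReal_le_ofReal key

/-- Concavity of the entropy. -/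
lemma le_entropy_bind {α β : Type*} (w : PMF α) (κ : α → PMF β) :
    ∑' a, w a * entropy (κ a) ≤ entropy (w.bind κ) := by
  have h : ∑' a, w a * ∑' b, (info (κ a b) * κ a b + κ a b) ≤
      ∑' a, w a * ∑' b, (info (w.bind κ b) * κ a b + w.bind κ b) := by
    refine ENNReal.tsum_le_tsum fun a => ?_
    rcases eq_or_ne (w a) 0 with ha | ha
    · simp [ha]
    gcongr w a * ?_
    refine ENNReal.tsum_le_tsum fun b => ?_
    rcases eq_or_ne (κ a b) 0 with hb | hb
    · simp [hb]
    refine info_mul_add_le (PMF.coe_le_one _ _) (fun h0 => ?_) (PMF.coe_le_one _ _)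
    rw [PMF.bind_apply, ENNReal.tsum_eq_zero] at h0
    exact mul_ne_zero ha hb (h0 a)
  simp_rw [ENNReal.tsum_add, PMF.tsum_coe, mul_add, ENNReal.tsum_add, mul_one, PMF.tsum_coe] at h
  rw [ENNReal.add_le_add_iff_right ENNReal.one_ne_top, ← tsum_bind_mul] at h
  simpa only [entropy_eq_tsum_info] using h

/-! ### Convolution powers -/

section Group

variable {Γ : Type*} [Group Γ] (μ : PMF Γ)

lemma map_mul_left_apply (x y : Γ) : μ.map (fun g => x * g) y = μ (x⁻¹ * y) := by
  rw [PMF.map_apply, tsum_eq_single (x⁻¹ * y)]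
  · simp
  · intro g hg
    rw [if_neg]
    rintro rfl
    simp at hg

lemma convPow_one : convPow μ 1 = μ := by
  simp only [convPow, PMF.pure_bind, one_mul]
  exact PMF.map_id μ

lemma convPow_add (m n : ℕ) :
    convPow μ (m + n) = (convPow μ m).bind fun x => (convPow μ n).map fun g => x * g := by
  induction n with
  | zero =>
    simp [convPow, PMF.pure_map]
  | succ n ih =>
    rw [← add_assoc, convPow, ih, PMF.bind_bind, convPow]
    congr 1
    funext x
    rw [PMF.map_bind, PMF.bind_map]
    congr 1
    funext y
    rw [PMF.map_comp]
    simp [Function.comp_def, mul_assoc]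

lemma convPow_add_apply (m n : ℕ) (x : Γ) :
    convPow μ (m + n) x = ∑' y, convPow μ m y * convPow μ n (y⁻¹ * x) := by
  rw [convPow_add, PMF.bind_apply]
  simp_rw [map_mul_left_apply]

variable {μ} in
lemma convPow_inv (hμ : IsSymmetric μ) (n : ℕ) (g : Γ) : convPow μ n g⁻¹ = convPow μ n g := by
  induction n generalizing g with
  | zero => by_cases hg : g = 1 <;> simp [convPow, PMF.pure_apply, hg]
  | succ n ih =>
    rw [convPow_add_apply, add_comm n, convPow_add_apply, convPow_one,
      ← (Equiv.mulLeft g).tsum_eq fun y => μ y * convPow μ n (y⁻¹ * g)]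
    refine tsum_congr fun y => ?_
    simp only [Equiv.coe_mulLeft, mul_inv_rev, inv_mul_cancel_right]
    rw [ih, mul_comm, ← hμ, mul_inv_rev, inv_inv, inv_inv]

variable {μ} in
lemma convPow_two_one_pos (hμ : IsSymmetric μ) : convPow μ 2 1 ≠ 0 := by
  obtain ⟨g, hg⟩ := μ.support_nonempty
  rw [show 2 = 1 + 1 from rfl, convPow_add_apply, convPow_one]
  refine fun h => ?_
  have := ENNReal.tsum_eq_zero.1 h g
  rw [mul_one, hμ] at this
  exact hg (mul_self_eq_zero.1 this)

lemma entropy_map_mul_left (x : Γ) : entropy (μ.map fun g => x * g) = entropy μ := by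
  unfold entropy
  simp_rw [map_mul_left_apply]
  exact (Equiv.mulLeft x⁻¹).tsum_eq
    fun y => ENNReal.ofReal (-((μ y).toReal * Real.log (μ y).toReal))

lemma tsum_convPow_add (m n : ℕ) (f : Γ → ℝ≥0∞) :
    ∑' x, f x * convPow μ (m + n) x =
      ∑' x, ∑' y, f (x * y) * (convPow μ m x * convPow μ n y) := by
  rw [convPow_add, tsum_bind_mul]
  refine tsum_congr fun x => ?_
  simp_rw [map_mul_left_apply]
  rw [← (Equiv.mulLeft x).tsum_eq, ← ENNReal.tsum_mul_left]
  refine tsum_congr fun y => ?_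
  simp only [Equiv.coe_mulLeft, inv_mul_cancel_left]
  ring

lemma entropy_convPow_zero : entropy (convPow μ 0) = 0 := by
  rw [entropy, ENNReal.tsum_eq_zero]
  intro g
  by_cases hg : g = 1 <;> simp [convPow, PMF.pure_apply, hg]

lemma entropy_convPow_add_le (m n : ℕ) :
    entropy (convPow μ (m + n)) ≤ entropy (convPow μ m) + entropy (convPow μ n) := by
  rw [convPow_add]
  refine (entropy_bind_le _ _).trans ?_
  simp_rw [entropy_map_mul_left]
  rw [ENNReal.tsum_mul_right, PMF.tsum_coe, one_mul]

/-- By concavity, averaging translates of `μ` cannot lower the entropy. Hence infinite `entropy μ`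
forces `h = ∞`. -/
lemma entropy_le_convPow_succ (n : ℕ) : entropy μ ≤ entropy (convPow μ (n + 1)) := by
  rw [convPow]
  refine le_trans ?_ (le_entropy_bind _ _)
  simp_rw [entropy_map_mul_left]
  rw [ENNReal.tsum_mul_right, PMF.tsum_coe, one_mul]

lemma entropy_convPow_ne_top (h : entropy μ ≠ ∞) (n : ℕ) : entropy (convPow μ n) ≠ ∞ := by
  induction n with
  | zero => simp [entropy_convPow_zero]
  | succ n ih =>
    refine ne_top_of_le_ne_top (ENNReal.add_ne_top.2 ⟨ih, h⟩) ?_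
    simpa only [convPow_one] using entropy_convPow_add_le μ n 1

lemma tendsto_entropy_of_eq_top (h : entropy μ = ∞) :
    Tendsto (fun n : ℕ => entropy (convPow μ n) / n) atTop (𝓝 ∞) := by
  refine tendsto_const_nhds.congr' ?_
  filter_upwards [eventually_gt_atTop 0] with n hn
  obtain ⟨k, rfl⟩ := Nat.exists_eq_succ_of_ne_zero hn.ne'
  rw [top_le_iff.1 (h.symm.le.trans (entropy_le_convPow_succ μ k)), ENNReal.top_div_of_ne_top]
  exact ENNReal.natCast_ne_top _

lemma tendsto_asymptoticEntropy :
    Tendsto (fun n : ℕ => entropy (convPow μ n) / n) atTop (𝓝 (asymptoticEntropy μ)) := by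
  by_cases h : entropy μ = ∞
  · have := tendsto_entropy_of_eq_top μ h
    rwa [asymptoticEntropy, this.limUnder_eq]
  · exact (tendsto_div_of_subadditive (entropy_convPow_add_le μ) (entropy_convPow_ne_top μ h)).1

/-! ### The length of the walk -/

section Metric

variable [MetricSpace Γ]

lemma M₂_sq : M₂ μ ^ 2 = ∑' g, edist g 1 ^ 2 * μ g := by
  rw [M₂, ← ENNReal.rpow_natCast, ← ENNReal.rpow_mul]
  simp

lemma meanLength_le_M₂ : meanLength μ ≤ M₂ μ := by
  rw [← ENNReal.pow_le_pow_left_iff two_ne_zero, M₂_sq, meanLength]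
  have := tsum_mul_sq_le μ (fun g => edist g 1) fun _ => 1
  simpa [mul_comm] using this

variable [IsIsometricSMul Γ Γ]

lemma edist_mul_one_le (x y : Γ) : edist (x * y) 1 ≤ edist x 1 + edist y 1 := by
  calc edist (x * y) 1 ≤ edist (x * y) (x * 1) + edist (x * 1) 1 := edist_triangle _ _ _
    _ = edist x 1 + edist y 1 := by rw [edist_mul_left, mul_one, add_comm]

lemma meanLength_convPow_add_le (m n : ℕ) :
    meanLength (convPow μ (m + n)) ≤ meanLength (convPow μ m) + meanLength (convPow μ n) := by
  unfold meanLength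
  rw [tsum_convPow_add]
  calc _ ≤ ∑' x, ∑' y, (edist x 1 * convPow μ m x * convPow μ n y +
          convPow μ m x * (edist y 1 * convPow μ n y)) := by
        refine ENNReal.tsum_le_tsum fun x => ENNReal.tsum_le_tsum fun y => ?_
        calc _ ≤ (edist x 1 + edist y 1) * (convPow μ m x * convPow μ n y) := by
              gcongr
              exact edist_mul_one_le x y
          _ = _ := by ring
    _ = _ := by
        simp_rw [ENNReal.tsum_add, ENNReal.tsum_mul_left, ENNReal.tsum_mul_right, PMF.tsum_coe,
          mul_one, one_mul]

variable {μ}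

lemma meanLength_convPow_ne_top (h : M₂ μ ≠ ∞) (n : ℕ) : meanLength (convPow μ n) ≠ ∞ := by
  induction n with
  | zero =>
    have : meanLength (convPow μ 0) = 0 := by
      rw [meanLength, ENNReal.tsum_eq_zero]
      intro g
      by_cases hg : g = 1 <;> simp [convPow, PMF.pure_apply, hg]
    simp [this]
  | succ n ih =>
    refine ne_top_of_le_ne_top
      (ENNReal.add_ne_top.2 ⟨ih, ne_top_of_le_ne_top h (meanLength_le_M₂ μ)⟩) ?_
    simpa only [convPow_one] using meanLength_convPow_add_le μ n 1

lemma tendsto_drift (h : M₂ μ ≠ ∞) :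
    Tendsto (fun n : ℕ => meanLength (convPow μ n) / n) atTop (𝓝 (drift μ)) :=
  (tendsto_div_of_subadditive (meanLength_convPow_add_le μ) (meanLength_convPow_ne_top h)).1

lemma mul_drift_le (h : M₂ μ ≠ ∞) (n : ℕ) : n * drift μ ≤ meanLength (convPow μ n) :=
  (tendsto_div_of_subadditive (meanLength_convPow_add_le μ) (meanLength_convPow_ne_top h)).2.2 n

lemma secondMoment_convPow_two_le :
    ∑' x, convPow μ 2 x * edist x 1 ^ 2 ≤ 2 ^ 2 * M₂ μ ^ 2 := by
  simp_rw [mul_comm (convPow μ 2 _)]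
  rw [show 2 = 1 + 1 from rfl, tsum_convPow_add, convPow_one, M₂_sq]
  calc _ ≤ ∑' x, ∑' y, 2 * (edist x 1 ^ 2 * μ x * μ y + μ x * (edist y 1 ^ 2 * μ y)) := by
        refine ENNReal.tsum_le_tsum fun x => ENNReal.tsum_le_tsum fun y => ?_
        calc _ ≤ (edist x 1 + edist y 1) ^ 2 * (μ x * μ y) := by
              gcongr
              exact edist_mul_one_le x y
          _ = (edist x 1 ^ 2 + edist y 1 ^ 2 + 2 * (edist x 1 * edist y 1)) * (μ x * μ y) := by
              ring
          _ ≤ (edist x 1 ^ 2 + edist y 1 ^ 2 + (edist x 1 ^ 2 + edist y 1 ^ 2)) *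
                (μ x * μ y) := by
              gcongr
              exact two_mul_le_add_sq_ennreal _ _
          _ = _ := by ring
    _ = _ := by
        simp_rw [ENNReal.tsum_mul_left, ENNReal.tsum_add, ENNReal.tsum_mul_left,
          ENNReal.tsum_mul_right, PMF.tsum_coe, mul_one, one_mul]
        ring

/-- Symmetry makes a return at time `2` possible, so Cauchy-Schwarz against the indicator of `x ≠ 1`
gains a factor `1 - μ^{*2}(1) < 1`: `(2ℓ)² ≤ (E |X₂|)² < 4 M₂²`. -/
lemma drift_lt_M₂ (hμ : IsSymmetric μ) (h : M₂ μ ≠ ∞) (h0 : M₂ μ ≠ 0) : drift μ < M₂ μ := by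
  classical
  have h1 := mul_drift_le h 2
  have h2 : meanLength (convPow μ 2) ^ 2 ≤
      (∑' x, convPow μ 2 x * edist x 1 ^ 2) * (1 - convPow μ 2 1) := by
    have := tsum_mul_sq_le (convPow μ 2) (fun x => edist x 1) fun x => if x = 1 then 0 else 1
    have e1 : ∑' x, convPow μ 2 x * (edist x 1 * if x = 1 then 0 else 1) =
        meanLength (convPow μ 2) := by
      refine tsum_congr fun x => ?_
      by_cases hx : x = 1 <;> simp [hx, mul_comm]
    have e2 : ∑' x, convPow μ 2 x * (if x = 1 then 0 else 1) ^ 2 = 1 - convPow μ 2 1 := by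
      have h3 := (ENNReal.tsum_eq_add_tsum_ite (f := convPow μ 2) 1).symm
      rw [PMF.tsum_coe] at h3
      refine (ENNReal.eq_sub_of_add_eq (PMF.apply_ne_top _ _) ?_)
      rw [add_comm]
      refine Eq.trans ?_ h3
      congr 1
      refine tsum_congr fun x => ?_
      by_cases hx : x = 1 <;> simp [hx]
    rwa [e1, e2] at this
  have h3 : 1 - convPow μ 2 1 < 1 :=
    ENNReal.sub_lt_self ENNReal.one_ne_top one_ne_zero (convPow_two_one_pos hμ)
  have h4 : (2 : ℝ≥0∞) ^ 2 * M₂ μ ^ 2 ≠ 0 := by simp [h0]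
  have h5 : (2 : ℝ≥0∞) ^ 2 * M₂ μ ^ 2 ≠ ∞ :=
    ENNReal.mul_ne_top (by simp) (ENNReal.pow_ne_top h)
  have h6 : (2 * drift μ) ^ 2 < (2 * M₂ μ) ^ 2 :=
    calc (2 * drift μ) ^ 2 ≤ meanLength (convPow μ 2) ^ 2 := by
          gcongr
          exact_mod_cast h1
      _ ≤ 2 ^ 2 * M₂ μ ^ 2 * (1 - convPow μ 2 1) :=
          h2.trans (by gcongr; exact secondMoment_convPow_two_le)
      _ < 2 ^ 2 * M₂ μ ^ 2 * 1 := (ENNReal.mul_lt_mul_iff_right h4 h5).2 h3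
      _ = (2 * M₂ μ) ^ 2 := by ring
  have h7 := lt_of_pow_lt_pow_left' 2 h6
  exact (ENNReal.mul_lt_mul_iff_right two_ne_zero ENNReal.ofNat_ne_top).1 h7

lemma drift_div_M₂_lt_one (hμ : IsSymmetric μ) (h : M₂ μ ≠ ∞) : drift μ / M₂ μ < 1 := by
  by_cases h0 : M₂ μ = 0
  -- Here `drift μ ≤ M₂ μ = 0`, and `0 / 0 = 0` in `ℝ≥0∞`.
  · have h1 := mul_drift_le h 1
    rw [convPow_one] at h1
    replace h1 := h1.trans (meanLength_le_M₂ μ)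
    rw [h0, Nat.cast_one, one_mul, nonpos_iff_eq_zero] at h1
    simp [h1]
  · exact ENNReal.div_lt_of_lt_mul (by simpa using drift_lt_M₂ hμ h h0)

end Metric

end Group

/-! ### The spectral radius bounds the quadratic form of the walk -/

section Spectral

variable {Γ : Type*} [Group Γ] {μ : PMF Γ}

/-- The quadratic form `⟨u, Pⁿ u⟩`, where `P` is the Markov operator of the walk. -/
def form (μ : PMF Γ) (n : ℕ) (u : Γ → ℝ≥0∞) : ℝ≥0∞ :=
  ∑' x, ∑' y, u x * u y * convPow μ n (x * y⁻¹)

lemma tsum_convPow_mul_convPow (hμ : IsSymmetric μ) (m n : ℕ) (x y : Γ) :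
    ∑' z, convPow μ m (z * x⁻¹) * convPow μ n (z * y⁻¹) = convPow μ (m + n) (x * y⁻¹) := by
  rw [convPow_add_apply, ← (Equiv.divLeft x).tsum_eq fun w => convPow μ m w * _]
  refine tsum_congr fun z => ?_
  rw [Equiv.divLeft_apply, ← convPow_inv hμ m (z * x⁻¹), div_eq_mul_inv]
  simp [mul_assoc]

/-- Cauchy-Schwarz for `⟨u, Pⁿ u⟩`, with `‖Pⁿ u‖² = ⟨u, P²ⁿ u⟩` because `P` is self-adjoint. -/
lemma form_sq_le (hμ : IsSymmetric μ) (n : ℕ) (u : Γ → ℝ≥0∞) :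
    form μ n u ^ 2 ≤ (∑' x, u x ^ 2) * form μ (n + n) u := by
  have h := tsum_mul_sq_le (fun _ => 1) u fun z => ∑' y, u y * convPow μ n (z * y⁻¹)
  simp only [one_mul] at h
  refine le_trans (le_of_eq ?_) (h.trans (le_of_eq ?_))
  · rw [form]
    simp_rw [← ENNReal.tsum_mul_left, mul_assoc]
  · congr 1
    calc _ = ∑' z, ∑' x, ∑' y,
          u x * u y * (convPow μ n (z * x⁻¹) * convPow μ n (z * y⁻¹)) := by
          refine tsum_congr fun z => ?_
          rw [sq, ← ENNReal.tsum_mul_right]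
          refine tsum_congr fun x => ?_
          rw [← ENNReal.tsum_mul_left]
          exact tsum_congr fun y => by ring
      _ = ∑' x, ∑' y, ∑' z,
          u x * u y * (convPow μ n (z * x⁻¹) * convPow μ n (z * y⁻¹)) := by
          rw [ENNReal.tsum_comm]
          exact tsum_congr fun x => ENNReal.tsum_comm
      _ = form μ (n + n) u := by
          simp_rw [ENNReal.tsum_mul_left, tsum_convPow_mul_convPow hμ]
          rfl

lemma form_one_pow_le (hμ : IsSymmetric μ) {u : Γ → ℝ≥0∞} (hu : ∑' x, u x ^ 2 ≤ 1) (k : ℕ) :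
    form μ 1 u ^ 2 ^ k ≤ form μ (2 ^ k) u := by
  induction k with
  | zero => simp
  | succ k ih =>
    calc form μ 1 u ^ 2 ^ (k + 1) = (form μ 1 u ^ 2 ^ k) ^ 2 := by rw [pow_succ, pow_mul]
      _ ≤ form μ (2 ^ k) u ^ 2 := by gcongr
      _ ≤ 1 * form μ (2 ^ k + 2 ^ k) u := (form_sq_le hμ _ u).trans (by gcongr)
      _ = form μ (2 ^ (k + 1)) u := by rw [one_mul, ← two_mul, ← pow_succ']

/-- Cauchy-Schwarz in the convolution: both factors have the same `ℓ²` norm, whose square is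
`μ^{*2n}(1)` by symmetry. -/
lemma convPow_even_le (hμ : IsSymmetric μ) (n : ℕ) (g : Γ) :
    convPow μ (n + n) g ≤ convPow μ (n + n) 1 := by
  rw [← ENNReal.pow_le_pow_left_iff two_ne_zero, convPow_add_apply, convPow_add_apply]
  have h := tsum_mul_sq_le (fun _ => 1) (convPow μ n) fun y => convPow μ n (y⁻¹ * g)
  simp only [one_mul] at h
  refine h.trans (le_of_eq ?_)
  have e : ∑' y, convPow μ n (y⁻¹ * g) ^ 2 = ∑' y, convPow μ n y ^ 2 := by
    rw [← ((Equiv.inv Γ).trans (Equiv.mulRight g)).tsum_eq fun y => convPow μ n y ^ 2]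
    simp
  rw [e, ← sq]
  simp_rw [mul_one, convPow_inv hμ, sq]

lemma form_even_le (hμ : IsSymmetric μ) (n : ℕ) (u : Γ → ℝ≥0∞) :
    form μ (n + n) u ≤ (∑' x, u x) ^ 2 * convPow μ (n + n) 1 := by
  calc form μ (n + n) u ≤ ∑' x, ∑' y, u x * u y * convPow μ (n + n) 1 := by
        refine ENNReal.tsum_le_tsum fun x => ENNReal.tsum_le_tsum fun y => ?_
        gcongr
        exact convPow_even_le hμ n _
    _ = _ := by simp_rw [ENNReal.tsum_mul_right, ENNReal.tsum_mul_left, ENNReal.tsum_mul_right, sq]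

lemma eventually_convPow_one_le {r : ℝ} (hr : spectralRadius μ < r) :
    ∀ᶠ n in atTop, 0 < r ∧ (convPow μ n 1).toReal ≤ r ^ n := by
  have h1 : ∀ n : ℕ, (convPow μ n 1).toReal ≤ 1 := fun n =>
    ENNReal.toReal_mono ENNReal.one_ne_top (PMF.coe_le_one _ _)
  have hb : IsBoundedUnder (· ≤ ·) atTop
      fun n : ℕ => (convPow μ n 1).toReal ^ (1 / n : ℝ) :=
    isBoundedUnder_of ⟨1, fun n =>
      Real.rpow_le_one ENNReal.toReal_nonneg (h1 n) (by positivity)⟩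
  filter_upwards [eventually_lt_of_limsup_lt hr hb, eventually_gt_atTop 0] with n hn hn0
  have h2 : 0 ≤ (convPow μ n 1).toReal ^ (1 / n : ℝ) := Real.rpow_nonneg ENNReal.toReal_nonneg _
  refine ⟨h2.trans_lt hn, ?_⟩
  calc (convPow μ n 1).toReal = ((convPow μ n 1).toReal ^ (1 / n : ℝ)) ^ n := by
        rw [one_div, Real.rpow_inv_natCast_pow ENNReal.toReal_nonneg hn0.ne']
    _ ≤ r ^ n := pow_le_pow_left₀ h2 hn.le n

/-- The `2^k`-th power of the form is at most `‖u‖₁² μ^{*2^k}(1)`; on taking roots the constant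
`‖u‖₁²` disappears. -/
lemma form_one_le_of_tsum_ne_top (hμ : IsSymmetric μ) {u : Γ → ℝ≥0∞} (hu : ∑' x, u x ^ 2 ≤ 1)
    (hfin : ∑' x, u x ≠ ∞) :
    form μ 1 u ≠ ∞ ∧ (form μ 1 u).toReal ≤ spectralRadius μ := by
  have hC : (∑' x, u x) ^ 2 ≠ ∞ := ENNReal.pow_ne_top hfin
  have hpow : ∀ k : ℕ, form μ 1 u ^ 2 ^ (k + 1) ≤
      (∑' x, u x) ^ 2 * convPow μ (2 ^ (k + 1)) 1 := fun k => by
    refine (form_one_pow_le hμ hu (k + 1)).trans ?_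
    rw [pow_succ, mul_two]
    exact form_even_le hμ _ u
  have htop : form μ 1 u ≠ ∞ := fun h => by
    have := hpow 0
    rw [h, ENNReal.top_pow (by norm_num), top_le_iff] at this
    exact ENNReal.mul_ne_top hC (PMF.apply_ne_top _ _) this
  refine ⟨htop, le_of_forall_gt_imp_ge_of_dense fun r hr => ?_⟩
  by_contra! hlt
  obtain ⟨N, hN⟩ := eventually_atTop.1 (eventually_convPow_one_le hr)
  have hr0 : 0 < r := (hN N le_rfl).1
  have hbd : ∀ k ≥ N, ((form μ 1 u).toReal / r) ^ 2 ^ (k + 1) ≤ ((∑' x, u x) ^ 2).toReal :=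
    fun k hk => by
      have h1 := ENNReal.toReal_mono (ENNReal.mul_ne_top hC (PMF.apply_ne_top _ _)) (hpow k)
      rw [ENNReal.toReal_mul, ENNReal.toReal_pow (form μ 1 u)] at h1
      rw [div_pow, div_le_iff₀ (by positivity)]
      refine h1.trans (mul_le_mul_of_nonneg_left (hN _ ?_).2 ENNReal.toReal_nonneg)
      exact hk.le.trans ((Nat.lt_two_pow_self).le.trans
        (Nat.pow_le_pow_right two_pos (Nat.le_succ k)))
  have ht : Tendsto (fun k : ℕ => ((form μ 1 u).toReal / r) ^ 2 ^ (k + 1)) atTop atTop :=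
    (tendsto_pow_atTop_atTop_of_one_lt ((one_lt_div hr0).2 hlt)).comp
      ((tendsto_pow_atTop_atTop_of_one_lt one_lt_two).comp (tendsto_add_atTop_nat 1))
  obtain ⟨k, hk, hk'⟩ := ((eventually_ge_atTop N).and
    (ht.eventually_gt_atTop ((∑' x, u x) ^ 2).toReal)).exists
  exact absurd (hbd k hk) (not_le.2 hk')

lemma spectralRadius_nonneg (hμ : IsSymmetric μ) : 0 ≤ spectralRadius μ :=
  ENNReal.toReal_nonneg.trans
    (form_one_le_of_tsum_ne_top hμ (u := fun _ => 0) (by simp) (by simp)).2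

lemma form_one_le (hμ : IsSymmetric μ) {u : Γ → ℝ≥0∞} (hu : ∑' x, u x ^ 2 ≤ 1) :
    form μ 1 u ≤ ENNReal.ofReal (spectralRadius μ) := by
  classical
  rw [form, ← ENNReal.tsum_prod, ENNReal.tsum_eq_iSup_sum]
  refine iSup_le fun s => ?_
  -- A finite partial sum only sees `u` on the finite set `S`, and the truncation is summable.
  let S : Finset Γ := s.image Prod.fst ∪ s.image Prod.snd
  let v : Γ → ℝ≥0∞ := fun x => if x ∈ S then u x else 0
  have hv : ∑' x, v x ^ 2 ≤ 1 := by
    refine le_trans (ENNReal.tsum_le_tsum fun x => ?_) hu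
    by_cases hx : x ∈ S <;> simp [v, hx]
  have hvfin : ∑' x, v x ≠ ∞ := by
    rw [tsum_eq_sum (s := S) fun x hx => by simp [v, hx]]
    refine ENNReal.sum_ne_top.2 fun x hx h => ?_
    have := (ENNReal.le_tsum x).trans hv
    rw [h, ENNReal.top_pow two_ne_zero] at this
    simp at this
  obtain ⟨h1, h2⟩ := form_one_le_of_tsum_ne_top hμ hv hvfin
  refine le_trans ?_ ((ENNReal.ofReal_toReal h1).symm.le.trans (ENNReal.ofReal_le_ofReal h2))
  rw [form, ← ENNReal.tsum_prod]
  refine le_trans (Finset.sum_le_sum fun p hp => ?_) (ENNReal.sum_le_tsum s)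
  have hp1 : p.1 ∈ S := Finset.mem_union_left _ (Finset.mem_image_of_mem _ hp)
  have hp2 : p.2 ∈ S := Finset.mem_union_right _ (Finset.mem_image_of_mem _ hp)
  simp [v, hp1, hp2]

lemma summable_and_tsum_le_of_ofReal {ι : Type*} {f : ι → ℝ} (hf : ∀ i, 0 ≤ f i) {r : ℝ}
    (hr : 0 ≤ r) (h : ∑' i, ENNReal.ofReal (f i) ≤ ENNReal.ofReal r) :
    Summable f ∧ ∑' i, f i ≤ r := by
  have hs : Summable f := by
    have := ENNReal.summable_toReal (ne_top_of_le_ne_top ENNReal.ofReal_ne_top h)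
    simpa only [ENNReal.toReal_ofReal (hf _)] using this
  refine ⟨hs, ?_⟩
  rwa [← ENNReal.ofReal_tsum_of_nonneg hf hs, ENNReal.ofReal_le_ofReal_iff hr] at h

/-- `⟨√q, P √q⟩ ≤ ρ` for every probability measure `q`. -/
lemma summable_and_tsum_sqrt_le (hμ : IsSymmetric μ) (q : PMF Γ) :
    (Summable fun p : Γ × Γ =>
      (μ p.1).toReal * (√(q p.2).toReal * √(q (p.1⁻¹ * p.2)).toReal)) ∧
    ∑' p : Γ × Γ, (μ p.1).toReal * (√(q p.2).toReal * √(q (p.1⁻¹ * p.2)).toReal) ≤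
      spectralRadius μ := by
  refine summable_and_tsum_le_of_ofReal (fun p => by positivity) (spectralRadius_nonneg hμ) ?_
  let u : Γ → ℝ≥0∞ := fun x => ENNReal.ofReal √(q x).toReal
  have hu : ∑' x, u x ^ 2 ≤ 1 := by
    rw [← q.tsum_coe]
    refine (tsum_congr fun x => ?_).le
    rw [← ENNReal.ofReal_pow (Real.sqrt_nonneg _), Real.sq_sqrt ENNReal.toReal_nonneg,
      ENNReal.ofReal_toReal (q.apply_ne_top x)]
  refine le_trans (le_of_eq ?_) (form_one_le hμ hu)
  rw [ENNReal.tsum_prod', ENNReal.tsum_comm, form]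
  refine tsum_congr fun x => ?_
  rw [← (Equiv.divLeft x).tsum_eq]
  refine tsum_congr fun y => ?_
  rw [ENNReal.ofReal_mul ENNReal.toReal_nonneg, ENNReal.ofReal_mul (Real.sqrt_nonneg _),
    ENNReal.ofReal_toReal (μ.apply_ne_top _), Equiv.divLeft_apply, convPow_one, mul_comm,
    div_eq_mul_inv]
  simp [u, mul_assoc]

end Spectral

/-! ### The walk stopped at a geometric time -/

section Geometric

variable {ε : ℝ}

lemma hasSum_geometric_weight (hε : ε ∈ Set.Ioo (0 : ℝ) 1) (a b : ℝ) :
    HasSum (fun n : ℕ => ε * (1 - ε) ^ n * (a + n * b)) (a + (1 - ε) / ε * b) := by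
  have h0 : ε ≠ 0 := hε.1.ne'
  have h1 := hasSum_geometric_of_lt_one (r := 1 - ε) (by linarith [hε.2]) (by linarith [hε.1])
  have h2 := hasSum_coe_mul_geometric_of_norm_lt_one (r := 1 - ε)
    (by rw [Real.norm_eq_abs, abs_lt]; constructor <;> linarith [hε.1, hε.2])
  convert! (h1.mul_left (ε * a)).add (h2.mul_left (ε * b)) using 1
  · funext n
    ring
  · rw [sub_sub_cancel]
    field_simp

/-- The geometric distribution with parameter `ε`. -/
def geom (ε : ℝ) (hε : ε ∈ Set.Ioo (0 : ℝ) 1) : PMF ℕ :=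
  ⟨fun n => ENNReal.ofReal (ε * (1 - ε) ^ n), by
    have h := hasSum_geometric_weight hε 1 0
    simp only [mul_zero, add_zero, mul_one] at h
    rw [ENNReal.summable.hasSum_iff, ← ENNReal.ofReal_tsum_of_nonneg (fun n => ?_) h.summable,
      h.tsum_eq, ENNReal.ofReal_one]
    exact mul_nonneg hε.1.le (pow_nonneg (by linarith [hε.2]) n)⟩

lemma geom_apply (hε : ε ∈ Set.Ioo (0 : ℝ) 1) (n : ℕ) :
    geom ε hε n = ENNReal.ofReal (ε * (1 - ε) ^ n) := rfl

lemma tsum_geom_mul (hε : ε ∈ Set.Ioo (0 : ℝ) 1) {a b : ℝ} (ha : 0 ≤ a) (hb : 0 ≤ b) :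
    ∑' n : ℕ, geom ε hε n * ENNReal.ofReal (a + n * b) =
      ENNReal.ofReal (a + (1 - ε) / ε * b) := by
  have h := hasSum_geometric_weight hε a b
  have hw : ∀ n : ℕ, 0 ≤ ε * (1 - ε) ^ n := fun n =>
    mul_nonneg hε.1.le (pow_nonneg (by linarith [hε.2]) n)
  rw [← h.tsum_eq, ENNReal.ofReal_tsum_of_nonneg (fun n => mul_nonneg (hw n) (by positivity))
    h.summable]
  exact tsum_congr fun n => by rw [geom_apply, ENNReal.ofReal_mul (hw n)]

lemma entropy_geom (hε : ε ∈ Set.Ioo (0 : ℝ) 1) :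
    entropy (geom ε hε) = ENNReal.ofReal (-Real.log ε + (1 - ε) / ε * -Real.log (1 - ε)) := by
  have h1 : 0 < 1 - ε := by linarith [hε.2]
  have hl : 0 ≤ -Real.log ε := neg_nonneg.2 (Real.log_nonpos hε.1.le hε.2.le)
  have hl1 : 0 ≤ -Real.log (1 - ε) := neg_nonneg.2 (Real.log_nonpos h1.le (by linarith [hε.1]))
  rw [← tsum_geom_mul hε hl hl1, entropy_eq_tsum_info]
  refine tsum_congr fun n => ?_
  rw [mul_comm, info, geom_apply, ENNReal.toReal_ofReal (mul_nonneg hε.1.le (pow_nonneg h1.le n)),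
    Real.log_mul hε.1.ne' (pow_pos h1 n).ne', Real.log_pow]
  congr 2
  ring

variable {Γ : Type*} [Group Γ] (μ : PMF Γ)

/-- The law of the walk at an independent geometric time. -/
def resolvent (hε : ε ∈ Set.Ioo (0 : ℝ) 1) : PMF Γ :=
  (geom ε hε).bind (convPow μ)

/-- Either the clock stops at time `0`, or the walk makes a first step `g` and the memoryless clock
restarts. -/
lemma resolvent_apply (hε : ε ∈ Set.Ioo (0 : ℝ) 1) (x : Γ) :
    resolvent μ hε x = ENNReal.ofReal ε * convPow μ 0 x +
      ENNReal.ofReal (1 - ε) * ∑' g, μ g * resolvent μ hε (g⁻¹ * x) := by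
  have h1 : 0 ≤ 1 - ε := by linarith [hε.2]
  simp_rw [resolvent, PMF.bind_apply, ← ENNReal.tsum_mul_left]
  rw [tsum_eq_zero_add' ENNReal.summable, ENNReal.tsum_comm]
  congr 1
  · simp [geom_apply]
  · refine tsum_congr fun n => ?_
    rw [add_comm n 1, convPow_add_apply, convPow_one, ← ENNReal.tsum_mul_left]
    refine tsum_congr fun g => ?_
    rw [geom_apply, geom_apply, add_comm 1 n,
      show ε * (1 - ε) ^ (n + 1) = (1 - ε) * (ε * (1 - ε) ^ n) by ring,
      ENNReal.ofReal_mul h1]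
    ring

lemma hasSum_toReal {ι : Type*} (ν : PMF ι) : HasSum (fun i => (ν i).toReal) 1 := by
  have h := (ENNReal.summable_toReal ν.tsum_coe_ne_top).hasSum
  rwa [← ENNReal.tsum_toReal_eq ν.apply_ne_top, ν.tsum_coe, ENNReal.toReal_one] at h

lemma hasSum_resolvent [DecidableEq Γ] (hε : ε ∈ Set.Ioo (0 : ℝ) 1) (x : Γ) :
    HasSum (fun g => (μ g).toReal * (resolvent μ hε (g⁻¹ * x)).toReal)
      (((resolvent μ hε x).toReal - if x = 1 then ε else 0) / (1 - ε)) := by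
  have h1 : 0 < 1 - ε := by linarith [hε.2]
  have hT : ∑' g, μ g * resolvent μ hε (g⁻¹ * x) ≠ ∞ := by
    refine ne_top_of_le_ne_top ENNReal.one_ne_top (μ.tsum_coe ▸ ENNReal.tsum_le_tsum fun g => ?_)
    exact mul_le_of_le_one_right' (PMF.coe_le_one _ _)
  have h := (ENNReal.summable_toReal hT).hasSum
  rw [← ENNReal.tsum_toReal_eq fun g =>
    ENNReal.mul_ne_top (PMF.apply_ne_top _ _) (PMF.apply_ne_top _ _)] at h
  simp_rw [ENNReal.toReal_mul] at h
  convert h using 1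
  rw [div_eq_iff h1.ne', resolvent_apply, ENNReal.toReal_add
    (ENNReal.mul_ne_top ENNReal.ofReal_ne_top (PMF.apply_ne_top _ _))
    (ENNReal.mul_ne_top ENNReal.ofReal_ne_top hT), ENNReal.toReal_mul, ENNReal.toReal_mul,
    ENNReal.toReal_ofReal hε.1.le, ENNReal.toReal_ofReal h1.le]
  by_cases hx : x = 1 <;> simp [convPow, PMF.pure_apply, hx, mul_comm]

lemma entropy_resolvent_le (hε : ε ∈ Set.Ioo (0 : ℝ) 1) {C s : ℝ} (hC : 0 ≤ C) (hs : 0 ≤ s)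
    (h : ∀ n : ℕ, entropy (convPow μ n) ≤ ENNReal.ofReal (C + n * s)) :
    entropy (resolvent μ hε) ≤
      ENNReal.ofReal (C - Real.log ε + (1 - ε) / ε * (s - Real.log (1 - ε))) := by
  have h1 : 0 < 1 - ε := by linarith [hε.2]
  have hε0 := hε.1
  have hl : 0 ≤ -Real.log ε := neg_nonneg.2 (Real.log_nonpos hε.1.le hε.2.le)
  have hl1 : 0 ≤ -Real.log (1 - ε) := neg_nonneg.2 (Real.log_nonpos h1.le (by linarith [hε.1]))
  calc entropy (resolvent μ hε)
      ≤ entropy (geom ε hε) + ∑' n, geom ε hε n * entropy (convPow μ n) := entropy_bind_le _ _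
    _ ≤ entropy (geom ε hε) + ∑' n : ℕ, geom ε hε n * ENNReal.ofReal (C + n * s) := by
        gcongr with n
        exact h n
    _ = _ := by
        rw [tsum_geom_mul hε hC hs, entropy_geom, ← ENNReal.ofReal_add (by positivity)
          (by positivity)]
        congr 1
        ring

section Metric

variable [MetricSpace Γ] [IsIsometricSMul Γ Γ] {μ}

/-- The clock has mean `(1 - ε) / ε`, and `E |X_n| ≥ n ℓ` for every `n` by Fekete. -/
lemma le_meanLength_resolvent (hε : ε ∈ Set.Ioo (0 : ℝ) 1) (h : M₂ μ ≠ ∞) :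
    ENNReal.ofReal ((1 - ε) / ε * (drift μ).toReal) ≤ meanLength (resolvent μ hε) := by
  have htop : drift μ ≠ ∞ := fun h0 => by
    have := mul_drift_le h 1
    rw [h0, Nat.cast_one, one_mul, top_le_iff] at this
    exact meanLength_convPow_ne_top h 1 this
  rw [meanLength, resolvent, tsum_bind_mul]
  have := tsum_geom_mul hε le_rfl (ENNReal.toReal_nonneg (a := drift μ))
  simp only [zero_add] at this
  rw [← this]
  gcongr with n
  rw [ENNReal.ofReal_mul n.cast_nonneg, ENNReal.ofReal_natCast, ENNReal.ofReal_toReal htop]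
  exact mul_drift_le h n

lemma meanLength_resolvent_ne_top (hε : ε ∈ Set.Ioo (0 : ℝ) 1) (h : M₂ μ ≠ ∞) :
    meanLength (resolvent μ hε) ≠ ∞ := by
  have hlin : ∀ n : ℕ, meanLength (convPow μ n) ≤
      ENNReal.ofReal (0 + n * (meanLength μ).toReal) := fun n => by
    rw [zero_add, ENNReal.ofReal_mul n.cast_nonneg, ENNReal.ofReal_natCast,
      ENNReal.ofReal_toReal (ne_top_of_le_ne_top h (meanLength_le_M₂ μ))]
    induction n with
    | zero => simp [meanLength, convPow, PMF.pure_apply]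
    | succ n ih =>
      refine (meanLength_convPow_add_le μ n 1).trans ?_
      rw [convPow_one, Nat.cast_succ, add_mul, one_mul]
      gcongr
  rw [meanLength, resolvent, tsum_bind_mul]
  refine ne_top_of_le_ne_top ?_ (ENNReal.tsum_le_tsum fun n => mul_le_mul_right (hlin n) _)
  rw [tsum_geom_mul hε le_rfl ENNReal.toReal_nonneg]
  exact ENNReal.ofReal_ne_top

end Metric

end Geometric

/-! ### Sums over the edges `(x, g⁻¹ x)` -/

section Edges

variable {Γ : Type*} [Group Γ]

/-- The involution reversing the edge from `x` to `g⁻¹ x`. -/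
def edgeInv (Γ : Type*) [Group Γ] : Γ × Γ ≃ Γ × Γ where
  toFun p := (p.1⁻¹, p.1⁻¹ * p.2)
  invFun p := (p.1⁻¹, p.1⁻¹ * p.2)
  left_inv p := by simp
  right_inv p := by simp

lemma hasSum_edge {f G : Γ → ℝ} {a b : ℝ} (hf : HasSum f a) (hG : HasSum G b)
    (hinv : ∀ g, f g⁻¹ = f g) :
    HasSum (fun p : Γ × Γ => f p.1 * G p.2) (a * b) ∧
      HasSum (fun p : Γ × Γ => f p.1 * G (p.1⁻¹ * p.2)) (a * b) := by
  have h : HasSum (fun p : Γ × Γ => f p.1 * G p.2) (a * b) :=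
    hf.mul hG (summable_mul_of_summable_norm hf.summable.norm hG.summable.norm)
  refine ⟨h, ?_⟩
  rw [← (edgeInv Γ).hasSum_iff] at h
  refine h.congr_fun fun p => ?_
  simp [edgeInv, hinv]

variable {μ : PMF Γ} {ε : ℝ}

/-- Expanding the product gives two diagonal sums, each equal to `S`, and two cross sums, exchanged
by edge reversal and evaluated by the resolvent equation as `(S - F 1 * ε) / (1 - ε)`. -/
lemma hasSum_edge_resolvent (hμ : IsSymmetric μ) (hε : ε ∈ Set.Ioo (0 : ℝ) 1) {F : Γ → ℝ} {S : ℝ}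
    (hF : HasSum (fun x => F x * (resolvent μ hε x).toReal) S) :
    HasSum (fun p : Γ × Γ => (μ p.1).toReal * ((F p.2 - F (p.1⁻¹ * p.2)) *
        ((resolvent μ hε (p.1⁻¹ * p.2)).toReal - (resolvent μ hε p.2).toReal) / 2))
      (ε / (1 - ε) * (S - F 1)) := by
  classical
  have h1 : 0 < 1 - ε := by linarith [hε.2]
  set Q : Γ → ℝ := fun x => (resolvent μ hε x).toReal with hQ
  set m : Γ → ℝ := fun g => (μ g).toReal with hm
  have hQ0 : ∀ x, 0 ≤ Q x := fun x => ENNReal.toReal_nonneg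
  have hm0 : ∀ g, 0 ≤ m g := fun g => ENNReal.toReal_nonneg
  have hrec : ∀ x, HasSum (fun g => m g * Q (g⁻¹ * x)) ((Q x - if x = 1 then ε else 0) / (1 - ε)) :=
    hasSum_resolvent μ hε
  have hminv : ∀ g, m g⁻¹ = m g := fun g => by simp only [hm, hμ g]
  have hFrec : HasSum (fun x => F x * ((Q x - if x = 1 then ε else 0) / (1 - ε)))
      ((S - F 1 * ε) / (1 - ε)) := by
    have h2 : HasSum (fun x => F x * if x = 1 then ε else 0) (F 1 * ε) := by
      convert hasSum_ite_eq (1 : Γ) (F 1 * ε) using 2 with x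
      by_cases hx : x = 1 <;> simp [hx]
    refine ((hF.sub h2).div_const (1 - ε)).congr_fun fun x => ?_
    simp only [hQ]
    ring
  -- `F` may be unbounded, so absolute summability is checked fibrewise: the sum of norms over `g`
  -- is again given by the resolvent equation.
  have hsum : Summable fun p : Γ × Γ => F p.1 * (m p.2 * Q (p.2⁻¹ * p.1)) := by
    refine Summable.of_norm ((summable_prod_of_nonneg fun p => norm_nonneg _).2 ⟨fun x => ?_, ?_⟩)
    · exact ((hrec x).mul_left (F x)).summable.norm
    · refine hFrec.summable.norm.congr fun x => ?_
      simp_rw [norm_mul]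
      rw [tsum_mul_left, ← (hrec x).tsum_eq,
        Real.norm_of_nonneg (tsum_nonneg fun g => mul_nonneg (hm0 g) (hQ0 _))]
      congr 1
      exact tsum_congr fun g => by
        rw [Real.norm_of_nonneg (hm0 g), Real.norm_of_nonneg (hQ0 _)]
  have hA : HasSum (fun p : Γ × Γ => m p.1 * (F p.2 * Q (p.1⁻¹ * p.2)))
      ((S - F 1 * ε) / (1 - ε)) := by
    have h := hsum.hasSum
    rw [(h.prod_fiberwise fun x => (hrec x).mul_left (F x)).unique hFrec,
      ← (Equiv.prodComm Γ Γ).hasSum_iff] at h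
    refine h.congr_fun fun p => ?_
    simp only [Function.comp_apply, Equiv.prodComm_apply, Prod.fst_swap, Prod.snd_swap]
    ring
  have hB : HasSum (fun p : Γ × Γ => m p.1 * (F (p.1⁻¹ * p.2) * Q p.2))
      ((S - F 1 * ε) / (1 - ε)) := by
    rw [← (edgeInv Γ).hasSum_iff] at hA
    refine hA.congr_fun fun p => ?_
    simp [edgeInv, hminv]
  obtain ⟨hC, hD⟩ := hasSum_edge (hasSum_toReal μ) hF hminv
  convert! ((((hA.add hB).sub hC).sub hD).div_const 2) using 1
  · funext p
    simp only [hm, hQ]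
    ring
  · field_simp
    ring

/-- If `Q x = 0`, the resolvent equation kills every nonnegative term `μ g * Q (g⁻¹ x)`; reversing
the edge gives the converse. This supplies `hab` in `A_edge_le`. -/
lemma resolvent_eq_zero_iff (hμ : IsSymmetric μ) (hε : ε ∈ Set.Ioo (0 : ℝ) 1) {g : Γ}
    (hg : (μ g).toReal ≠ 0) (x : Γ) :
    (resolvent μ hε x).toReal = 0 ↔ (resolvent μ hε (g⁻¹ * x)).toReal = 0 := by
  classical
  have h1 : 0 < 1 - ε := by linarith [hε.2]
  have key : ∀ g : Γ, (μ g).toReal ≠ 0 → ∀ x, (resolvent μ hε x).toReal = 0 →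
      (resolvent μ hε (g⁻¹ * x)).toReal = 0 := by
    intro g hg x hx
    have h := le_hasSum (hasSum_resolvent μ hε x) g fun _ _ => by positivity
    rw [hx] at h
    have h2 : (0 - if x = 1 then ε else 0) / (1 - ε) ≤ 0 := by
      refine div_nonpos_of_nonpos_of_nonneg (sub_nonpos.2 ?_) h1.le
      split_ifs
      exacts [hε.1.le, le_rfl]
    have h3 : (μ g).toReal * (resolvent μ hε (g⁻¹ * x)).toReal = 0 :=
      le_antisymm (h.trans h2) (by positivity)
    exact (mul_eq_zero.1 h3).resolve_left hg
  refine ⟨key g hg x, fun h => ?_⟩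
  simpa using key g⁻¹ (by rwa [hμ]) (g⁻¹ * x) h

lemma hasSum_log_resolvent (hε : ε ∈ Set.Ioo (0 : ℝ) 1) (h : entropy (resolvent μ hε) ≠ ∞) :
    HasSum (fun x => -Real.log (resolvent μ hε x).toReal * (resolvent μ hε x).toReal)
      (entropy (resolvent μ hε)).toReal := by
  have hs := (ENNReal.summable_toReal h).hasSum
  rw [← ENNReal.tsum_toReal_eq fun _ => ENNReal.ofReal_ne_top] at hs
  refine hs.congr_fun fun x => ?_
  rw [ENNReal.toReal_ofReal]
  · ring
  · rw [neg_nonneg]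
    exact mul_nonpos_of_nonneg_of_nonpos ENNReal.toReal_nonneg
      (Real.log_nonpos ENNReal.toReal_nonneg
        (ENNReal.toReal_mono ENNReal.one_ne_top (PMF.coe_le_one _ _)))

variable [MetricSpace Γ]

lemma hasSum_meanLength {ν : PMF Γ} (h : meanLength ν ≠ ∞) :
    HasSum (fun x => dist x 1 * (ν x).toReal) (meanLength ν).toReal := by
  have hs := (ENNReal.summable_toReal h).hasSum
  rw [← ENNReal.tsum_toReal_eq fun x =>
    ENNReal.mul_ne_top (edist_ne_top _ _) (PMF.apply_ne_top _ _)] at hs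
  refine hs.congr_fun fun x => ?_
  rw [ENNReal.toReal_mul, ← dist_edist]

lemma hasSum_M₂_sq (h : M₂ μ ≠ ∞) :
    HasSum (fun g => (μ g).toReal * dist g 1 ^ 2) ((M₂ μ).toReal ^ 2) := by
  have h2 := ENNReal.pow_ne_top (n := 2) h
  rw [M₂_sq] at h2
  have hs := (ENNReal.summable_toReal h2).hasSum
  rw [← ENNReal.tsum_toReal_eq fun x =>
    ENNReal.mul_ne_top (ENNReal.pow_ne_top (edist_ne_top _ _)) (PMF.apply_ne_top _ _),
    ← M₂_sq, ENNReal.toReal_pow] at hs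
  refine hs.congr_fun fun x => ?_
  rw [ENNReal.toReal_mul, ENNReal.toReal_pow, ← dist_edist, mul_comm]

variable [IsIsometricSMul Γ Γ]

lemma dist_inv_one (g : Γ) : dist g⁻¹ 1 = dist g 1 := by
  rw [← dist_mul_left g, mul_inv_cancel, mul_one, dist_comm]

lemma abs_dist_sub_dist_le (g x : Γ) : |dist x 1 - dist (g⁻¹ * x) 1| ≤ dist g 1 := by
  have h : dist (g⁻¹ * x) 1 = dist x g := by
    rw [← dist_mul_left g, mul_inv_cancel_left, mul_one]
  rw [h, dist_comm x 1, dist_comm x g]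
  exact (abs_dist_sub_le 1 g x).trans (dist_comm 1 g).le

/-- The main inequality, for the walk at a geometric time. -/
lemma A_le_entropy_resolvent (hμ : IsSymmetric μ) (hM : M₂ μ ≠ ∞) (hε : ε ∈ Set.Ioo (0 : ℝ) 1)
    (hH : entropy (resolvent μ hε) ≠ ∞) :
    A (drift μ / M₂ μ).toReal + 4 * (1 - spectralRadius μ) ≤
      ε / (1 - ε) * (entropy (resolvent μ hε)).toReal := by
  have h1 : 0 < 1 - ε := by linarith [hε.2]
  have hε0 := hε.1
  set Q : Γ → ℝ := fun x => (resolvent μ hε x).toReal with hQ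
  set m : Γ → ℝ := fun g => (μ g).toReal with hm
  have hminv : ∀ g, m g⁻¹ = m g := fun g => by simp only [hm, hμ g]
  have hQ0 : ∀ x, 0 ≤ Q x := fun x => ENNReal.toReal_nonneg
  have hm0 : ∀ g, 0 ≤ m g := fun g => ENNReal.toReal_nonneg
  have hx1 := drift_div_M₂_lt_one hμ hM
  set x₀ := (drift μ / M₂ μ).toReal with hx₀
  have hx₀0 : 0 ≤ x₀ := ENNReal.toReal_nonneg
  have hx₀1 : x₀ < 1 := by
    rw [← ENNReal.toReal_one]
    exact ENNReal.toReal_strict_mono ENNReal.one_ne_top hx1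
  set l := (drift μ).toReal
  set M := (M₂ μ).toReal
  have hxM : x₀ = l / M := ENNReal.toReal_div _ _
  -- For `M ≠ 0` this is `l / M²`, the maximizer of `2 t l - t² M²`, whose maximum is `x₀²`: exactly
  -- what cancels the tangent's constant.
  set t := x₀ / M with ht
  have ht0 : 0 ≤ t := div_nonneg hx₀0 ENNReal.toReal_nonneg
  have htl : t * l = x₀ ^ 2 := by rw [ht, hxM]; ring
  have htM : t ^ 2 * M ^ 2 = x₀ ^ 2 := by
    rcases eq_or_ne M 0 with h | h
    · rw [hxM, h]; simp
    · rw [ht]; field_simp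
  have hc := slopeA_nonneg hx₀0 hx₀1
  have hdist := hasSum_edge_resolvent hμ hε
    (hasSum_meanLength (meanLength_resolvent_ne_top hε hM))
  have hlog := hasSum_edge_resolvent hμ hε (hasSum_log_resolvent hε hH)
  obtain ⟨hsqrt, hρ⟩ := summable_and_tsum_sqrt_le hμ (resolvent μ hε)
  obtain ⟨hT1, hT2⟩ := hasSum_edge (hasSum_toReal μ) (hasSum_toReal (resolvent μ hε)) hminv
  obtain ⟨hS1, hS2⟩ := hasSum_edge (hasSum_M₂_sq hM) (hasSum_toReal (resolvent μ hε))
    fun g => by rw [hμ, dist_inv_one]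
  have hT := (hT1.add hT2).div_const 2
  have hS := (hS1.add hS2).div_const 2
  have hL := (hT.mul_left (A x₀ - slopeA x₀ * x₀ ^ 2)).add
    (((hdist.mul_left (2 * t)).sub (hS.mul_left (t ^ 2))).mul_left (slopeA x₀))
  have hR := (hlog.add (hsqrt.hasSum.mul_left 4)).sub (hT.mul_left 4)
  have hle := hasSum_le (fun p => ?_) hL hR
  · have hD : l ≤ ε / (1 - ε) * (meanLength (resolvent μ hε)).toReal := by
      have h := ENNReal.toReal_mono (meanLength_resolvent_ne_top hε hM)
        (le_meanLength_resolvent hε hM)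
      rw [ENNReal.toReal_ofReal (mul_nonneg (by positivity) ENNReal.toReal_nonneg)] at h
      calc l = ε / (1 - ε) * ((1 - ε) / ε * l) := by field_simp
        _ ≤ _ := by gcongr
    -- For `F = -log Q` the boundary term `F 1` is nonnegative, so it may be dropped.
    have hQ1 : 0 ≤ -Real.log (resolvent μ hε 1).toReal :=
      neg_nonneg.2 (Real.log_nonpos ENNReal.toReal_nonneg
        (ENNReal.toReal_mono ENNReal.one_ne_top (PMF.coe_le_one _ _)))
    have hK : ε / (1 - ε) * ((entropy (resolvent μ hε)).toReal -
        -Real.log (resolvent μ hε 1).toReal) ≤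
        ε / (1 - ε) * (entropy (resolvent μ hε)).toReal := by
      gcongr
      linarith
    have hD' := mul_le_mul_of_nonneg_left (mul_le_mul_of_nonneg_left hD ht0) hc
    rw [htl] at hD'
    simp only [dist_self, sub_zero, mul_one] at hle
    have e1 : slopeA x₀ * (t ^ 2 * ((M ^ 2 + M ^ 2) / 2)) = slopeA x₀ * x₀ ^ 2 := by
      rw [← htM]; ring
    linarith
  · rcases eq_or_ne (m p.1) 0 with h0 | h0
    · simp only [hm] at h0
      simp [h0]
    have hedge := A_edge_le hx₀0 hx₀1 (hQ0 p.2) (hQ0 (p.1⁻¹ * p.2))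
      (resolvent_eq_zero_iff hμ hε h0 p.2) t (dist p.1 1)
    have habs : (dist p.2 1 - dist (p.1⁻¹ * p.2) 1) * (Q (p.1⁻¹ * p.2) - Q p.2) ≤
        dist p.1 1 * |Q (p.1⁻¹ * p.2) - Q p.2| := by
      refine (le_abs_self _).trans ?_
      rw [abs_mul]
      gcongr
      exact abs_dist_sub_dist_le _ _
    have hedge' := mul_le_mul_of_nonneg_left hedge (hm0 p.1)
    have habs' := mul_le_mul_of_nonneg_left habs
      (mul_nonneg (hm0 p.1) (mul_nonneg hc ht0))
    simp only [hm, hQ] at hedge' habs' ⊢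
    linarith

end Edges

/-! ### The limit -/

section Limit

variable {Γ : Type*} [Group Γ] {μ : PMF Γ}

lemma exists_entropy_convPow_le (hH : entropy μ ≠ ∞) {s : ℝ} (hs : 0 ≤ s)
    (hh : asymptoticEntropy μ < ENNReal.ofReal s) :
    ∃ C : ℝ, 0 ≤ C ∧ ∀ n : ℕ, entropy (convPow μ n) ≤ ENNReal.ofReal (C + n * s) := by
  obtain ⟨N, hN⟩ := eventually_atTop.1 ((tendsto_asymptoticEntropy μ).eventually_lt_const hh)
  have hC : 0 ≤ ∑ k ∈ Finset.range (N + 1), (entropy (convPow μ k)).toReal :=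
    Finset.sum_nonneg fun _ _ => ENNReal.toReal_nonneg
  refine ⟨_, hC, fun n => ?_⟩
  -- The early terms are absorbed in the constant; cutting at `N + 1` rather than `N` keeps `n ≠ 0`
  -- in the other case.
  rcases lt_or_ge n (N + 1) with hn | hn
  · refine (ENNReal.ofReal_toReal (entropy_convPow_ne_top μ hH n)).symm.le.trans
      (ENNReal.ofReal_le_ofReal ?_)
    have := Finset.single_le_sum (f := fun k => (entropy (convPow μ k)).toReal)
      (fun _ _ => ENNReal.toReal_nonneg) (Finset.mem_range.2 hn)
    exact this.trans (le_add_of_nonneg_right (by positivity))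
  · have hn0 : (n : ℝ≥0∞) ≠ 0 := by
      have : n ≠ 0 := by omega
      exact_mod_cast this
    have h := (ENNReal.div_le_iff hn0 (ENNReal.natCast_ne_top n)).1 (hN n (by omega)).le
    refine h.trans ?_
    rw [← ENNReal.ofReal_natCast, ← ENNReal.ofReal_mul hs, mul_comm]
    exact ENNReal.ofReal_le_ofReal (le_add_of_nonneg_left hC)

variable [MetricSpace Γ] [IsIsometricSMul Γ Γ]

lemma A_le_asymptoticEntropy (hμ : IsSymmetric μ) (hM : M₂ μ ≠ ∞)
    (hh : asymptoticEntropy μ ≠ ∞) :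
    A (drift μ / M₂ μ).toReal + 4 * (1 - spectralRadius μ) ≤ (asymptoticEntropy μ).toReal := by
  have hH : entropy μ ≠ ∞ := fun h =>
    hh (tendsto_nhds_unique (tendsto_asymptoticEntropy μ) (tendsto_entropy_of_eq_top μ h))
  refine le_of_forall_gt_imp_ge_of_dense fun s hs => ?_
  have hs0 : 0 ≤ s := ENNReal.toReal_nonneg.trans hs.le
  obtain ⟨C, hC, hCs⟩ := exists_entropy_convPow_le hH hs0 ((ENNReal.lt_ofReal_iff_toReal_lt hh).2 hs)
  -- This is the bound of `entropy_resolvent_le` times `ε / (1 - ε)`; the term `-ε log ε` is written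
  -- with `Real.negMulLog`, continuous with value `0` at `0`.
  have hlim : Tendsto (fun ε : ℝ => ε / (1 - ε) * C + Real.negMulLog ε / (1 - ε) + s -
      Real.log (1 - ε)) (𝓝[>] 0) (𝓝 s) := by
    have hc : ContinuousAt (fun ε : ℝ => ε / (1 - ε) * C + Real.negMulLog ε / (1 - ε) + s -
        Real.log (1 - ε)) 0 := by
      have h1 : ContinuousAt (fun ε : ℝ => 1 - ε) 0 := by fun_prop
      have h2 : (1 : ℝ) - 0 ≠ 0 := by norm_num
      exact ((((continuousAt_id.div h1 h2).mul_const C).add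
        (Real.continuous_negMulLog.continuousAt.div h1 h2)).add_const s).sub (h1.log h2)
    have := hc.tendsto.mono_left (nhdsWithin_le_nhds (s := Set.Ioi 0))
    simpa using this
  refine ge_of_tendsto hlim ?_
  filter_upwards [Ioo_mem_nhdsGT one_pos] with ε hε
  have h1 : 0 < 1 - ε := by linarith [hε.2]
  have hε0 := hε.1
  have hle := entropy_resolvent_le μ hε hC hs0 hCs
  refine (A_le_entropy_resolvent hμ hM hε (ne_top_of_le_ne_top ENNReal.ofReal_ne_top hle)).trans ?_
  have hl : Real.log ε ≤ 0 := Real.log_nonpos hε.1.le hε.2.le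
  have hl1 : Real.log (1 - ε) ≤ 0 := Real.log_nonpos h1.le (by linarith)
  have hle' := ENNReal.toReal_le_of_le_ofReal
    (add_nonneg (by linarith) (mul_nonneg (by positivity) (by linarith))) hle
  calc _ ≤ ε / (1 - ε) * (C - Real.log ε + (1 - ε) / ε * (s - Real.log (1 - ε))) := by gcongr
    _ = _ := by
      rw [Real.negMulLog]
      field_simp
      ring

end Limit

lemma coe_le_coe_ennreal {a : ℝ} {b : ℝ≥0∞} (h : b ≠ ∞ → a ≤ b.toReal) : (a : EReal) ≤ b := by
  rcases eq_or_ne b ∞ with rfl | hb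
  · simp
  · rw [← ENNReal.ofReal_toReal hb, EReal.coe_ennreal_ofReal]
    exact_mod_cast (h hb).trans (le_max_left _ _)

end RandomWalk

end

theorem mainTheorem8 {Γ : Type*} [Group Γ] [Countable Γ] [MetricSpace Γ] [IsIsometricSMul Γ Γ]
    (hproper : ∀ r : ℝ, (Metric.closedBall (1 : Γ) r).Finite)
    (μ : PMF Γ) (hsymm : RandomWalk.IsSymmetric μ) (hM₂ : RandomWalk.M₂ μ ≠ ∞) :
    -- nonnegativity of `A` on its domain
    (∀ x ∈ Set.Ioo (-1 : ℝ) 1, 0 ≤ RandomWalk.A x) ∧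
    -- the limits defining `h` and `ℓ` exist, and `ℓ / M₂(μ)` lies in the domain of `A`
    Tendsto (fun n : ℕ => RandomWalk.entropy (RandomWalk.convPow μ n) / n) atTop
      (𝓝 (RandomWalk.asymptoticEntropy μ)) ∧
    Tendsto (fun n : ℕ => RandomWalk.meanLength (RandomWalk.convPow μ n) / n) atTop
      (𝓝 (RandomWalk.drift μ)) ∧
    RandomWalk.drift μ / RandomWalk.M₂ μ < 1 ∧
    -- the inequality, and Ledrappier's inequality, which it strengthens
    ((RandomWalk.A (RandomWalk.drift μ / RandomWalk.M₂ μ).toReal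
        + 4 * (1 - RandomWalk.spectralRadius μ) : ℝ) : EReal)
      ≤ (RandomWalk.asymptoticEntropy μ : EReal) ∧
    ((4 * (1 - RandomWalk.spectralRadius μ) : ℝ) : EReal)
      ≤ (RandomWalk.asymptoticEntropy μ : EReal) := by
  have hlt := RandomWalk.drift_div_M₂_lt_one hsymm hM₂
  have hA : 0 ≤ RandomWalk.A (RandomWalk.drift μ / RandomWalk.M₂ μ).toReal := by
    refine RandomWalk.A_nonneg ⟨neg_one_lt_zero.trans_le ENNReal.toReal_nonneg, ?_⟩
    rw [← ENNReal.toReal_one]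
    exact ENNReal.toReal_strict_mono ENNReal.one_ne_top hlt
  have hmain := RandomWalk.A_le_asymptoticEntropy hsymm hM₂
  exact ⟨fun x => RandomWalk.A_nonneg, RandomWalk.tendsto_asymptoticEntropy μ,
    RandomWalk.tendsto_drift hM₂, hlt, RandomWalk.coe_le_coe_ennreal hmain,
    RandomWalk.coe_le_coe_ennreal fun h => (le_add_of_nonneg_left hA).trans (hmain h)⟩
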